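/- A word is a finite sequence of distinct letters of an alphabet $\mathcal A$. For words $u,v$ let $u_v$ be the subword of $u$ formed by those letters of $u$ that occur in $v$. A shuffle of disjoint words $u$ and $v$ is a word $s$ whose set of letters is the union of the letters of $u$ and of $v$ and which satisfies $s_u=u$, $s_v=v$. Let $m,n\ge 0$ and fix disjoint words $x=x_1\cdots x_m$ and $y=y_1\cdots y_n$. The poset of shuffles $\mathcal W_{m,n}$ consists of all shuffles of a subword of $x$ with a subword of $y$, ordered by: $v\le w$ if and only if $v_x\supseteq w_x$ and $v_y\subseteq w_y$ as sets and $v_w=w_v$ as words. It has least element $\hat 0=x$ and greatest element $\hat 1=y$, and it is graded of rank $m+n$ by $\rho(w)=(m-|w_x|)+|w_y|$. Let $\mu$ be its Möbius function and let $$\chi(\mathcal W_{m,n},t)=\sum_{w\in\mathcal W_{m,n}}\mu(\hat 0,w)\,t^{\,\rho(\hat 1)-\rho(w)}$$ be its characteristic polynomial. Then $$\chi(\mathcal W_{m,n},t)=(t-1)^m\sum_{i=0}^n(-1)^i\binom ni\binom{m+i}{i}t^{n-i},$$ and $$\mu(\mathcal W_{m,n})=\mu(\hat 0,\hat 1)=(-1)^{m+n}\binom{m+n}{n}.$$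 -/

import Mathlib

open Polynomial

universe u

namespace Shuffle

section Graded

/-- The characteristic polynomial `∑ x, μ(0̂, x) t ^ (ρ(1̂) - ρ(x))` of a finite bounded graded poset.
The rank function `ρ` is `grade ℕ`: it is strictly monotone, increases by one along every covering
relation and vanishes at the least element. -/
noncomputable def charPoly (P : Type u) [PartialOrder P] [BoundedOrder P] [Fintype P]
    [LocallyFiniteOrder P] [DecidableEq P] [GradeMinOrder ℕ P] : ℤ[X] :=
  ∑ w : P, C (IncidenceAlgebra.mu ℤ (⊥ : P) w) * X ^ (grade ℕ (⊤ : P) - grade ℕ w)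

end Graded

variable {A : Type u} [DecidableEq A]

/-- The restriction of `u` to `v`: the subword of `u` formed by its letters that occur in `v`. -/
def restrict (u v : List A) : List A := u.filter (fun a => decide (a ∈ v))

/-- The word `s` (a list of distinct letters) is a shuffle of `u` and `v`. -/
structure IsShuffle (u v s : List A) : Prop where
  nodup : s.Nodup
  mem_iff : ∀ a, a ∈ s ↔ a ∈ u ∨ a ∈ v
  restrict_left : restrict s u = u
  restrict_right : restrict s v = v

/-- A pair of disjoint words `x = x₁ ⋯ xₘ` and `y = y₁ ⋯ yₙ` over the alphabet `A`; a word is a list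
of distinct letters. -/
structure DisjointWords (A : Type u) (m n : ℕ) where
  x : List A
  y : List A
  nodup_x : x.Nodup
  nodup_y : y.Nodup
  disjoint : x.Disjoint y
  length_x : x.length = m
  length_y : y.length = n

variable {m n : ℕ}

/-- The elements of the poset of shuffles: all shuffles of a subword of `x` with a subword of `y`. -/
def ShufflePoset (p : DisjointWords A m n) : Type u :=
  {w : List A // ∃ a b : List A, a.Sublist p.x ∧ b.Sublist p.y ∧ IsShuffle a b w}

namespace ShufflePoset

variable {p : DisjointWords A m n}

/-- The underlying word of an element. -/
def word (w : ShufflePoset p) : List A := w.1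

theorem word_injective : Function.Injective (word (p := p)) := Subtype.val_injective

theorem nodup (w : ShufflePoset p) : w.word.Nodup := by
  obtain ⟨w, a, b, ha, hb, h⟩ := w
  exact h.nodup

theorem mem_or (w : ShufflePoset p) {c : A} (hc : c ∈ w.word) : c ∈ p.x ∨ c ∈ p.y := by
  obtain ⟨w, a, b, ha, hb, h⟩ := w
  rcases (h.mem_iff c).1 hc with h1 | h1
  · exact Or.inl (ha.subset h1)
  · exact Or.inr (hb.subset h1)

instance : DecidableEq (ShufflePoset p) :=
  inferInstanceAs (DecidableEq {_w : List A // _})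

/-- `v ≤ w` if `v_x ⊇ w_x` and `v_y ⊆ w_y` as sets, and `v_w = w_v` as words. -/
instance : LE (ShufflePoset p) where
  le v w := restrict w.word p.x ⊆ restrict v.word p.x ∧
    restrict v.word p.y ⊆ restrict w.word p.y ∧
    restrict v.word w.word = restrict w.word v.word

theorem le_def {v w : ShufflePoset p} : v ≤ w ↔ restrict w.word p.x ⊆ restrict v.word p.x ∧
    restrict v.word p.y ⊆ restrict w.word p.y ∧
    restrict v.word w.word = restrict w.word v.word := Iff.rfl

theorem le_iff {v w : ShufflePoset p} : v ≤ w ↔ (∀ c ∈ w.word, c ∈ p.x → c ∈ v.word) ∧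
    (∀ c ∈ v.word, c ∈ p.y → c ∈ w.word) ∧
    restrict v.word w.word = restrict w.word v.word := by
  simp only [le_def, restrict, List.subset_def, List.mem_filter, decide_eq_true_eq]
  grind

instance : PartialOrder (ShufflePoset p) where
  le_refl v := ⟨fun _ h => h, fun _ h => h, rfl⟩
  le_trans u v w huv hvw := by
    rw [le_iff] at *
    obtain ⟨h1, h2, h3⟩ := huv
    obtain ⟨k1, k2, k3⟩ := hvw
    refine ⟨fun c hc hx => h1 c (k1 c hc hx) hx, fun c hc hy => k2 c (h2 c hc hy) hy, ?_⟩
    have key : ∀ c, c ∈ u.word → c ∈ w.word → c ∈ v.word := by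
      intro c hu hw
      rcases u.mem_or hu with hx | hy
      · exact k1 c hw hx
      · exact h2 c hu hy
    have e1 := congrArg (List.filter (fun a => decide (a ∈ w.word))) h3
    have e2 := congrArg (List.filter (fun a => decide (a ∈ u.word))) k3
    simp only [restrict, List.filter_filter] at *
    calc _ = List.filter (fun a => decide (a ∈ w.word) && decide (a ∈ v.word)) u.word :=
          List.filter_congr (by grind)
      _ = _ := e1
      _ = List.filter (fun a => decide (a ∈ u.word) && decide (a ∈ w.word)) v.word :=
          List.filter_congr (by grind)
      _ = _ := e2
      _ = _ := List.filter_congr (by grind)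
  le_antisymm v w hvw hwv := by
    rw [le_iff] at *
    obtain ⟨h1, h2, h3⟩ := hvw
    obtain ⟨k1, k2, k3⟩ := hwv
    apply word_injective
    have e1 : restrict v.word w.word = v.word := by
      refine List.filter_eq_self.2 fun c hc => ?_
      rcases v.mem_or hc with hx | hy
      · simpa using k1 c hc hx
      · simpa using h2 c hc hy
    have e2 : restrict w.word v.word = w.word := by
      refine List.filter_eq_self.2 fun c hc => ?_
      rcases w.mem_or hc with hx | hy
      · simpa using h1 c hc hx
      · simpa using k2 c hc hy
    rw [← e1, h3, e2]

instance : Finite (ShufflePoset p) := by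
  refine Finite.of_injective
    (β := {l : List {c // c ∈ p.x ++ p.y} // l.Nodup})
    (fun w => ⟨w.word.attach.map fun c => ⟨c.1, by simpa using w.mem_or c.2⟩, ?_⟩) ?_
  · refine (List.nodup_attach.2 w.nodup).map ?_
    intro a b h
    simpa [Subtype.ext_iff] using h
  · intro v w h
    apply word_injective
    have := congrArg (List.map Subtype.val) (congrArg Subtype.val h)
    simpa using this

noncomputable instance : Fintype (ShufflePoset p) := Fintype.ofFinite _

open Classical in
noncomputable instance : LocallyFiniteOrder (ShufflePoset p) := Fintype.toLocallyFiniteOrder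

theorem restrict_comm_aux {x y a b w : List A} (hx : x.Nodup) (hd : x.Disjoint y)
    (ha : a.Sublist x) (hb : b.Sublist y) (hm : ∀ c, c ∈ w ↔ c ∈ a ∨ c ∈ b)
    (hr : restrict w a = a) : restrict x w = restrict w x := by
  have hax : ∀ c ∈ w, c ∈ x ↔ c ∈ a := fun c hc => by
    have := (hm c).1 hc
    have := fun h => ha.subset (a := c) h
    have := fun h => hb.subset (a := c) h
    have := @hd c
    tauto
  have hwx : ∀ c ∈ x, c ∈ w ↔ c ∈ a := fun c hc => by
    have := hm c
    have := fun h => hb.subset (a := c) h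
    have := @hd c
    tauto
  have e1 : restrict w x = a := by
    conv_rhs => rw [← hr]
    exact List.filter_congr fun c hc => by simp [hax c hc]
  have e2 : restrict x w = restrict x a :=
    List.filter_congr fun c hc => by simp [hwx c hc]
  rw [e1, e2]
  have hsub : a.Sublist (restrict x a) := by
    have h := ha.filter (fun c => decide (c ∈ a))
    rwa [List.filter_eq_self.2 (by simp)] at h
  refine (hsub.eq_of_length_le ?_).symm
  refine ((hx.filter _).subperm ?_).length_le
  intro c hc
  simpa using (List.mem_filter.1 hc).2

theorem restrict_x_comm (w : ShufflePoset p) : restrict p.x w.word = restrict w.word p.x := by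
  obtain ⟨w, a, b, ha, hb, h⟩ := w
  exact restrict_comm_aux p.nodup_x p.disjoint ha hb h.mem_iff h.restrict_left

theorem restrict_y_comm (w : ShufflePoset p) : restrict p.y w.word = restrict w.word p.y := by
  obtain ⟨w, a, b, ha, hb, h⟩ := w
  exact restrict_comm_aux p.nodup_y p.disjoint.symm hb ha
    (fun c => (h.mem_iff c).trans or_comm) h.restrict_right

instance : BoundedOrder (ShufflePoset p) where
  bot := ⟨p.x, p.x, [], List.Sublist.refl _, List.nil_sublist _,
    p.nodup_x, by simp, by simp [restrict], by simp [restrict]⟩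
  top := ⟨p.y, [], p.y, List.nil_sublist _, List.Sublist.refl _,
    p.nodup_y, by simp, by simp [restrict], by simp [restrict]⟩
  bot_le w := le_iff.2 ⟨fun _ _ hx => hx, fun _ hc hy => (p.disjoint hc hy).elim,
    w.restrict_x_comm⟩
  le_top w := le_iff.2 ⟨fun _ hc hx => (p.disjoint hx hc).elim, fun _ _ hy => hy,
    w.restrict_y_comm.symm⟩

/-- The rank function `ρ(w) = (m - |w_x|) + |w_y|`. -/
def rank (w : ShufflePoset p) : ℕ :=
  (m - (restrict w.word p.x).length) + (restrict w.word p.y).length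

theorem length_restrict_x_le (w : ShufflePoset p) : (restrict w.word p.x).length ≤ m := by
  rw [← w.restrict_x_comm]
  exact (List.length_filter_le _ _).trans p.length_x.le

theorem rank_strictMono : StrictMono (rank (p := p)) := by
  intro v w hvw
  obtain ⟨h1, h2, h3⟩ := le_def.1 hvw.le
  have s1 := (w.nodup.filter (fun c => decide (c ∈ p.x))).subperm h1
  have s2 := (v.nodup.filter (fun c => decide (c ∈ p.y))).subperm h2
  have l1 : (restrict w.word p.x).length ≤ (restrict v.word p.x).length := s1.length_le
  have l2 : (restrict v.word p.y).length ≤ (restrict w.word p.y).length := s2.length_le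
  have b1 := v.length_restrict_x_le
  by_contra hlt
  unfold rank at hlt
  have q1 := s1.perm_of_length_le (show (restrict v.word p.x).length ≤ _ by
    change _ ≤ (restrict w.word p.x).length
    omega)
  have q2 := s2.perm_of_length_le (show (restrict w.word p.y).length ≤ _ by
    change _ ≤ (restrict v.word p.y).length
    omega)
  exact hvw.not_ge (le_def.2 ⟨fun c hc => q1.mem_iff.2 hc, fun c hc => q2.mem_iff.2 hc, h3.symm⟩)

/-- Deleting a letter from a shuffle gives a shuffle. -/
def delete (w : ShufflePoset p) (c : A) : ShufflePoset p :=
  ⟨w.word.filter (fun d => decide (d ≠ c)), by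
    obtain ⟨w, a, b, ha, hb, h⟩ := w
    refine ⟨a.filter (fun d => decide (d ≠ c)), b.filter (fun d => decide (d ≠ c)),
      List.filter_sublist.trans ha, List.filter_sublist.trans hb, h.nodup.filter _, ?_, ?_, ?_⟩
    · intro d
      have := h.mem_iff d
      simp only [word, List.mem_filter]
      tauto
    · conv_rhs => rw [← h.restrict_left]
      simp only [word, restrict, List.filter_filter]
      exact List.filter_congr (by grind)
    · conv_rhs => rw [← h.restrict_right]
      simp only [word, restrict, List.filter_filter]
      exact List.filter_congr (by grind)⟩

theorem word_delete (w : ShufflePoset p) (c : A) :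
    (w.delete c).word = w.word.filter (fun d => decide (d ≠ c)) := rfl

theorem length_restrict_delete (w : ShufflePoset p) {c : A} (hc : c ∈ w.word) {z : List A}
    (hz : c ∈ z) :
    (restrict (w.delete c).word z).length + 1 = (restrict w.word z).length := by
  have hm : c ∈ restrict w.word z := by simp [restrict, hc, hz]
  have hn : (restrict w.word z).Nodup := w.nodup.filter _
  have e : restrict (w.delete c).word z = (restrict w.word z).erase c := by
    rw [hn.erase_eq_filter, word_delete]
    simp only [restrict, List.filter_filter]
    exact List.filter_congr (by grind)
  rw [e, List.length_erase_of_mem hm]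
  have := List.length_pos_of_mem hm
  omega

theorem restrict_delete_of_notMem (w : ShufflePoset p) {c : A} {z : List A} (hz : c ∉ z) :
    restrict (w.delete c).word z = restrict w.word z := by
  rw [word_delete]
  simp only [restrict, List.filter_filter]
  exact List.filter_congr (by grind)

theorem restrict_delete_self (w : ShufflePoset p) (c : A) :
    restrict (w.delete c).word w.word = restrict w.word (w.delete c).word := by
  rw [word_delete]
  simp only [restrict, List.filter_filter]
  exact List.filter_congr (by grind)

theorem restrict_delete_left (v w : ShufflePoset p) {c : A} (hc : c ∉ w.word)
    (h : restrict v.word w.word = restrict w.word v.word) :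
    restrict (v.delete c).word w.word = restrict w.word (v.delete c).word := by
  rw [restrict_delete_of_notMem v hc, h, word_delete]
  exact List.filter_congr (by grind)

theorem rank_covBy {v w : ShufflePoset p} (h : v ⋖ w) : w.rank = v.rank + 1 := by
  obtain ⟨h1, h2, h3⟩ := le_iff.1 h.le
  by_cases hx : ∃ c ∈ v.word, c ∈ p.x ∧ c ∉ w.word
  · obtain ⟨c, hcv, hcx, hcw⟩ := hx
    have hcy : c ∉ p.y := fun hy => p.disjoint hcx hy
    have hr : (v.delete c).rank = v.rank + 1 := by
      have e1 := v.length_restrict_delete hcv hcx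
      have e2 := v.restrict_delete_of_notMem hcy
      have := v.length_restrict_x_le
      unfold rank
      rw [e2]
      omega
    have k1 : v ≤ v.delete c := le_iff.2 ⟨by simp +contextual [word_delete],
      by simp only [word_delete]; grind, (v.restrict_delete_self c).symm⟩
    have k2 : v.delete c ≤ w := le_iff.2 ⟨by simp only [word_delete]; grind,
      by simp only [word_delete]; grind, restrict_delete_left v w hcw h3⟩
    rcases h.eq_or_eq k1 k2 with e | e
    · rw [e] at hr; omega
    · rw [← e, hr]
  · have hy : ∃ c ∈ w.word, c ∈ p.y ∧ c ∉ v.word := by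
      by_contra hy
      push Not at hx hy
      exact h.lt.not_ge (le_iff.2 ⟨hx, hy, h3.symm⟩)
    obtain ⟨c, hcw, hcy, hcv⟩ := hy
    have hcx : c ∉ p.x := fun hx => p.disjoint hx hcy
    have hr : (w.delete c).rank + 1 = w.rank := by
      have e1 := w.length_restrict_delete hcw hcy
      have e2 := w.restrict_delete_of_notMem hcx
      unfold rank
      rw [e2]
      omega
    have k1 : w.delete c ≤ w := le_iff.2 ⟨by simp only [word_delete]; grind,
      by simp +contextual [word_delete], w.restrict_delete_self c⟩
    have k2 : v ≤ w.delete c := le_iff.2 ⟨by simp only [word_delete]; grind,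
      by simp only [word_delete]; grind, (restrict_delete_left w v hcv h3.symm).symm⟩
    rcases h.eq_or_eq k2 k1 with e | e
    · rw [← hr, e]
    · rw [e] at hr; omega

theorem rank_bot : (⊥ : ShufflePoset p).rank = 0 := by
  have e1 : restrict (⊥ : ShufflePoset p).word p.x = p.x :=
    List.filter_eq_self.2 fun c hc => by simpa using (show c ∈ p.x from hc)
  have e2 : restrict (⊥ : ShufflePoset p).word p.y = [] :=
    List.filter_eq_nil_iff.2 fun c hc => by
      simpa using fun hy => p.disjoint (show c ∈ p.x from hc) hy
  simp [rank, e1, e2, p.length_x]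

instance : GradeMinOrder ℕ (ShufflePoset p) where
  grade := rank
  grade_strictMono := rank_strictMono
  covBy_grade _ _ h := Nat.covBy_iff_add_one_eq.2 (rank_covBy h).symm
  isMin_grade v hv := by
    rw [hv.eq_bot, rank_bot]
    exact isMin_bot

end ShufflePoset
end Shuffle

/-! Call a shuffle full if it contains every letter of `x`. The claim behind both formulas is that
`μ(0̂, w)` equals `(-1) ^ ρ(w)` times the number of full `s` from which `w` arises by deleting
letters of `x`; this is `mu_bot`.

Summing any function against this candidate becomes a sum over pairs `(s, D)`, with `s` full and `D`
a set of letters of `x` to delete (`sum_signedCount_mul`). By `deleteAll_le_iff`, the deleted word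
lies below `w` iff `s ≤ w` and `D` misses `w`. Hence the sum over `[0̂, w]` factors: the alternating
sum over `D` vanishes unless `w` is full, and then the full `s ≤ w` form a Boolean lattice on the
`y`-letters of `w`, whose alternating sum vanishes unless `w = 0̂`. This is the recursion defining
`μ`.

In the characteristic polynomial the sum over `D` gives `(t - 1) ^ m`. The sum over `s` is grouped
by its set of `i` letters from `y`: there are `n.choose i` sets, each carried by `(m + i).choose i`
shuffles. -/

namespace Shuffle

/-! ### Counting shuffles of two words -/

/-- Words with prescribed letters satisfying `q` and prescribed letters not satisfying `q`. -/
theorem exists_finset_filter_eq {A : Type u} [DecidableEq A] (q : A → Bool) (u v : List A)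
    (hu : ∀ a ∈ u, q a = true) (hv : ∀ a ∈ v, q a = false) :
    ∃ S : Finset (List A), S.card = (u.length + v.length).choose v.length ∧
      ∀ s, s ∈ S ↔ s.filter q = u ∧ s.filter (fun a => !q a) = v := by
  induction u generalizing v with
  | nil =>
    refine ⟨{v}, by simp, fun s => ?_⟩
    rw [Finset.mem_singleton]
    constructor
    · rintro rfl
      exact ⟨List.filter_eq_nil_iff.2 fun a ha => by simp [hv a ha],
        List.filter_eq_self.2 fun a ha => by simp [hv a ha]⟩
    · rintro ⟨h1, h2⟩
      rw [← h2, eq_comm, List.filter_eq_self]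
      intro a ha
      simpa using List.filter_eq_nil_iff.1 h1 a ha
  | cons a u ihu =>
    induction v with
    | nil =>
      refine ⟨{a :: u}, by simp, fun s => ?_⟩
      rw [Finset.mem_singleton]
      constructor
      · rintro rfl
        exact ⟨List.filter_eq_self.2 hu,
          List.filter_eq_nil_iff.2 fun c hc => by simp [hu c hc]⟩
      · rintro ⟨h1, h2⟩
        rw [← h1, eq_comm, List.filter_eq_self]
        intro c hc
        simpa using List.filter_eq_nil_iff.1 h2 c hc
    | cons b v ihv =>
      have ha := hu a (by simp)
      have hb := hv b (by simp)
      obtain ⟨S, hS, hS'⟩ := ihu (b :: v) (fun c hc => hu c (by simp [hc])) hv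
      obtain ⟨T, hT, hT'⟩ := ihv (fun c hc => hv c (by simp [hc]))
      -- Splitting by the first letter, `a` or `b`, gives Pascal's rule; `q` tells the two cases
      -- apart.
      refine ⟨S.map ⟨List.cons a, List.cons_injective⟩ ∪ T.map ⟨List.cons b, List.cons_injective⟩,
        ?_, ?_⟩
      · rw [Finset.card_union_of_disjoint, Finset.card_map, Finset.card_map, hS, hT]
        · simp only [List.length_cons]
          rw [show u.length + 1 + (v.length + 1) = (u.length + 1 + v.length) + 1 by ring,
            Nat.choose_succ_succ, add_comm]
          congr 2
          ring
        · rw [Finset.disjoint_left]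
          intro s h1 h2
          simp only [Finset.mem_map, Function.Embedding.coeFn_mk] at h1 h2
          obtain ⟨s1, -, rfl⟩ := h1
          obtain ⟨s2, -, h⟩ := h2
          have hab : b = a := (List.cons.inj h).1
          rw [hab, ha] at hb
          exact Bool.noConfusion hb
      · intro s
        simp only [Finset.mem_union, Finset.mem_map, Function.Embedding.coeFn_mk, hS', hT']
        constructor
        · rintro (⟨s, ⟨h1, h2⟩, rfl⟩ | ⟨s, ⟨h1, h2⟩, rfl⟩)
          · simp [ha, h1, h2]
          · simp [hb, h1, h2]
        · rintro ⟨h1, h2⟩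
          cases s with
          | nil => simp at h1
          | cons c s =>
            cases hc : q c
            · simp only [List.filter_cons, hc, Bool.not_false, if_true, List.cons.injEq] at h1 h2
              exact Or.inr ⟨s, ⟨by simpa using h1, h2.2⟩, by rw [h2.1]⟩
            · simp only [List.filter_cons, hc, Bool.not_true, if_true, List.cons.injEq] at h1 h2
              exact Or.inl ⟨s, ⟨h1.2, by simpa using h2⟩, by rw [h1.1]⟩

/-! ### Letter sets and rank -/

namespace ShufflePoset

variable {A : Type u} [DecidableEq A] {m n : ℕ} {p : DisjointWords A m n}

/-- The set of letters of the second word that occur in `w`. -/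
def ySet (w : ShufflePoset p) : Finset A := p.y.toFinset.filter (· ∈ w.word)

/-- The set of letters of the first word that do not occur in `w`. -/
def xMissing (w : ShufflePoset p) : Finset A := p.x.toFinset.filter (· ∉ w.word)

theorem mem_ySet {w : ShufflePoset p} {c : A} : c ∈ w.ySet ↔ c ∈ p.y ∧ c ∈ w.word := by
  simp [ySet]

theorem mem_xMissing {w : ShufflePoset p} {c : A} :
    c ∈ w.xMissing ↔ c ∈ p.x ∧ c ∉ w.word := by
  simp [xMissing]

theorem card_x (p : DisjointWords A m n) : p.x.toFinset.card = m := by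
  rw [List.toFinset_card_of_nodup p.nodup_x, p.length_x]

theorem card_y (p : DisjointWords A m n) : p.y.toFinset.card = n := by
  rw [List.toFinset_card_of_nodup p.nodup_y, p.length_y]

theorem rank_eq (w : ShufflePoset p) : w.rank = w.xMissing.card + w.ySet.card := by
  have h1 : (restrict w.word p.x).length = (p.x.toFinset.filter (· ∈ w.word)).card := by
    rw [← w.restrict_x_comm, restrict, ← List.toFinset_card_of_nodup (p.nodup_x.filter _)]
    congr 1
    ext c
    simp
  have h2 : (restrict w.word p.y).length = w.ySet.card := by
    rw [← w.restrict_y_comm, restrict, ← List.toFinset_card_of_nodup (p.nodup_y.filter _)]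
    congr 1
    ext c
    simp [mem_ySet]
  have h3 := Finset.card_filter_add_card_filter_not (s := p.x.toFinset) (· ∈ w.word)
  rw [card_x] at h3
  rw [rank, h1, h2, xMissing]
  omega

/-! ### Deleting sets of letters -/

/-- Deleting a set of letters from a shuffle. -/
def deleteAll (w : ShufflePoset p) (D : Finset A) : ShufflePoset p :=
  ⟨w.word.filter (fun d => decide (d ∉ D)), by
    obtain ⟨w, a, b, ha, hb, h⟩ := w
    refine ⟨a.filter (fun d => decide (d ∉ D)), b.filter (fun d => decide (d ∉ D)),
      List.filter_sublist.trans ha, List.filter_sublist.trans hb, h.nodup.filter _, ?_, ?_, ?_⟩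
    · intro d
      have := h.mem_iff d
      simp only [word, List.mem_filter]
      tauto
    · conv_rhs => rw [← h.restrict_left]
      simp only [word, restrict, List.filter_filter]
      exact List.filter_congr (by grind)
    · conv_rhs => rw [← h.restrict_right]
      simp only [word, restrict, List.filter_filter]
      exact List.filter_congr (by grind)⟩

theorem word_deleteAll (w : ShufflePoset p) (D : Finset A) :
    (w.deleteAll D).word = w.word.filter (fun d => decide (d ∉ D)) := rfl

theorem mem_deleteAll {w : ShufflePoset p} {D : Finset A} {c : A} :
    c ∈ (w.deleteAll D).word ↔ c ∈ w.word ∧ c ∉ D := by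
  simp [word_deleteAll]

theorem restrict_deleteAll_self (w : ShufflePoset p) (D : Finset A) :
    restrict (w.deleteAll D).word w.word = restrict w.word (w.deleteAll D).word := by
  rw [word_deleteAll]
  simp only [restrict, List.filter_filter]
  exact List.filter_congr (by grind)

theorem le_deleteAll (s : ShufflePoset p) {D : Finset A} (hD : D ⊆ p.x.toFinset) :
    s ≤ s.deleteAll D := by
  refine le_iff.2 ⟨fun c hc _ => (mem_deleteAll.1 hc).1, fun c hc hy => mem_deleteAll.2 ⟨hc, ?_⟩,
    (s.restrict_deleteAll_self D).symm⟩
  exact fun h => p.disjoint (List.mem_toFinset.1 (hD h)) hy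

theorem deleteAll_le (s : ShufflePoset p) {D : Finset A} (hD : D ⊆ p.y.toFinset) :
    s.deleteAll D ≤ s := by
  refine le_iff.2 ⟨fun c hc hx => mem_deleteAll.2 ⟨hc, ?_⟩, fun c hc _ => (mem_deleteAll.1 hc).1,
    s.restrict_deleteAll_self D⟩
  exact fun h => p.disjoint hx (List.mem_toFinset.1 (hD h))

theorem eq_deleteAll {v w : ShufflePoset p} (h : restrict v.word w.word = restrict w.word v.word)
    (hwv : ∀ c ∈ w.word, c ∈ v.word) {D : Finset A}
    (hD : ∀ c ∈ v.word, c ∈ D ↔ c ∉ w.word) : w = v.deleteAll D := by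
  apply word_injective
  have e : restrict w.word v.word = w.word := List.filter_eq_self.2 fun c hc => by simp [hwv c hc]
  rw [← e, ← h, word_deleteAll]
  exact List.filter_congr fun c hc => by simp [hD c hc]

/-- Since `s` has all of `x`, the condition on `x`-letters says that no letter of `D` occurs in `w`;
deleting such letters does not change the restriction to `w`. The conditions on `s` and `D` are thus
independent, so double sums factor. -/
theorem deleteAll_le_iff {s w : ShufflePoset p} {D : Finset A}
    (hs : ∀ c ∈ p.x, c ∈ s.word) (hD : D ⊆ p.x.toFinset) :
    s.deleteAll D ≤ w ↔ s ≤ w ∧ D ⊆ w.xMissing := by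
  constructor
  · intro h
    refine ⟨(s.le_deleteAll hD).trans h, fun c hc => ?_⟩
    have hx := List.mem_toFinset.1 (hD hc)
    exact mem_xMissing.2 ⟨hx, fun hw => (mem_deleteAll.1 ((le_iff.1 h).1 c hw hx)).2 hc⟩
  · rintro ⟨h, hDw⟩
    obtain ⟨-, h2, h3⟩ := le_iff.1 h
    have hDw' : ∀ c ∈ D, c ∉ w.word := fun c hc => (mem_xMissing.1 (hDw hc)).2
    refine le_iff.2 ⟨fun c hc hx => mem_deleteAll.2 ⟨hs c hx, fun h => hDw' c h hc⟩,
      fun c hc hy => h2 c (mem_deleteAll.1 hc).1 hy, ?_⟩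
    have e1 : restrict (s.deleteAll D).word w.word = restrict s.word w.word := by
      rw [word_deleteAll]
      simp only [restrict, List.filter_filter]
      exact List.filter_congr (by grind)
    rw [e1, h3]
    exact List.filter_congr fun c hc => by
      have := hDw' c
      simp only [mem_deleteAll]
      grind

theorem xMissing_deleteAll {s : ShufflePoset p} {D : Finset A}
    (hs : ∀ c ∈ p.x, c ∈ s.word) (hD : D ⊆ p.x.toFinset) : (s.deleteAll D).xMissing = D := by
  ext c
  have := @hD c
  have := hs c
  simp only [mem_xMissing, mem_deleteAll, List.mem_toFinset] at *
  tauto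

theorem ySet_deleteAll {s : ShufflePoset p} {D : Finset A} (hD : D ⊆ p.x.toFinset) :
    (s.deleteAll D).ySet = s.ySet := by
  ext c
  have := @hD c
  have := @p.disjoint c
  simp only [mem_ySet, mem_deleteAll, List.mem_toFinset] at *
  tauto

theorem rank_deleteAll {s : ShufflePoset p} {D : Finset A}
    (hs : ∀ c ∈ p.x, c ∈ s.word) (hD : D ⊆ p.x.toFinset) :
    (s.deleteAll D).rank = D.card + s.ySet.card := by
  rw [rank_eq, xMissing_deleteAll hs hD, ySet_deleteAll hD]

/-! ### Full elements and their deletions -/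

/-- The elements that contain all letters of the first word. -/
noncomputable def full (p : DisjointWords A m n) : Finset (ShufflePoset p) :=
  Finset.univ.filter fun s => ∀ c ∈ p.x, c ∈ s.word

theorem mem_full {s : ShufflePoset p} : s ∈ full p ↔ ∀ c ∈ p.x, c ∈ s.word := by
  simp [full]

open scoped Classical in
/-- The elements obtained from `s` by deleting letters of the first word. -/
noncomputable def xDeletions (s : ShufflePoset p) : Finset (ShufflePoset p) :=
  p.x.toFinset.powerset.image s.deleteAll

/-- Deletion from a full element is injective in `D`, which is recovered as the set of missing
letters of `x`. -/
theorem sum_xDeletions {M : Type*} [AddCommMonoid M] {s : ShufflePoset p} (hs : s ∈ full p)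
    (F : ShufflePoset p → M) :
    ∑ w ∈ s.xDeletions, F w = ∑ D ∈ p.x.toFinset.powerset, F (s.deleteAll D) := by
  classical
  refine Finset.sum_image fun D hD E hE h => ?_
  rw [Finset.mem_coe, Finset.mem_powerset] at hD hE
  rw [← xMissing_deleteAll (mem_full.1 hs) hD, ← xMissing_deleteAll (mem_full.1 hs) hE, h]

theorem ySet_eq_of_mem_xDeletions {s w : ShufflePoset p} (h : w ∈ s.xDeletions) :
    s.ySet = w.ySet := by
  classical
  obtain ⟨D, hD, rfl⟩ := Finset.mem_image.1 h
  rw [ySet_deleteAll (Finset.mem_powerset.1 hD)]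

theorem mem_xDeletions_top {s : ShufflePoset p} (hs : s.ySet = p.y.toFinset) :
    ⊤ ∈ s.xDeletions := by
  classical
  refine Finset.mem_image.2 ⟨p.x.toFinset, Finset.mem_powerset_self _, ?_⟩
  have hy : ∀ c ∈ p.y, c ∈ s.word := fun c hc =>
    (mem_ySet.1 (hs ▸ List.mem_toFinset.2 hc)).2
  refine (eq_deleteAll (le_iff.1 (le_top (a := s))).2.2 hy fun c hc => ?_).symm
  rw [List.mem_toFinset]
  exact ⟨fun h h' => p.disjoint h h', fun h => (s.mem_or hc).resolve_right h⟩

/-! ### The Möbius function as a signed count -/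

/-- The signed number of ways to obtain `w` from a full element by deleting letters of the first
word. -/
noncomputable def signedCount (w : ShufflePoset p) : ℤ := by
  classical
  exact ∑ s ∈ full p, if w ∈ s.xDeletions then (-1) ^ w.rank else 0

/-- Exchange of summation. It serves twice: with the indicator of `v ≤ w` over `ℤ`, and with powers
of `X` over `ℤ[X]`. -/
theorem sum_signedCount_mul {R : Type*} [CommRing R] (F : ShufflePoset p → R) :
    ∑ w, (signedCount w : R) * F w = ∑ s ∈ full p, ∑ D ∈ p.x.toFinset.powerset,
      (-1) ^ (D.card + s.ySet.card) * F (s.deleteAll D) := by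
  classical
  simp only [signedCount, Int.cast_sum, Finset.sum_mul]
  rw [Finset.sum_comm]
  refine Finset.sum_congr rfl fun s hs => ?_
  have h := sum_xDeletions hs fun w => (-1 : R) ^ w.rank * F w
  calc _ = ∑ w ∈ s.xDeletions, (-1 : R) ^ w.rank * F w := by
        rw [← Finset.sum_filter_add_sum_filter_not Finset.univ (· ∈ s.xDeletions),
          Finset.sum_eq_zero (s := Finset.univ.filter (· ∉ s.xDeletions)), add_zero]
        · refine Finset.sum_congr (by ext; simp) fun w hw => ?_
          simp [hw]
        · intro w hw
          simp [(Finset.mem_filter.1 hw).2]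
    _ = _ := h
    _ = _ := Finset.sum_congr rfl fun D hD => by
        rw [rank_deleteAll (mem_full.1 hs) (Finset.mem_powerset.1 hD)]

open scoped Classical in
-- A full `s` below a full `w` is `w` with some letters of `y` deleted, so these `s` correspond to
-- the subsets of `w.ySet`.
theorem sum_full_le {w : ShufflePoset p} (hw : w ∈ full p) :
    ∑ s ∈ (full p).filter (· ≤ w), (-1 : ℤ) ^ s.ySet.card = if w.ySet = ∅ then 1 else 0 := by
  rw [← Finset.sum_powerset_neg_one_pow_card]
  have hE : ∀ E ∈ w.ySet.powerset, (w.deleteAll (w.ySet \ E)).ySet = E := by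
    intro E hE
    ext c
    have hEw := Finset.mem_powerset.1 hE
    have := @hEw c
    simp only [mem_ySet, mem_deleteAll, Finset.mem_sdiff] at *
    tauto
  refine Finset.sum_bij' (fun s _ => s.ySet) (fun E _ => w.deleteAll (w.ySet \ E)) ?_ ?_ ?_ hE
    fun _ _ => rfl
  · intro s hs
    have h := (le_iff.1 (Finset.mem_filter.1 hs).2).2.1
    exact Finset.mem_powerset.2 fun c hc => mem_ySet.2
      ⟨(mem_ySet.1 hc).1, h c (mem_ySet.1 hc).2 (mem_ySet.1 hc).1⟩
  · intro E hE
    refine Finset.mem_filter.2 ⟨mem_full.2 fun c hc => mem_deleteAll.2 ⟨mem_full.1 hw c hc, ?_⟩,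
      w.deleteAll_le ?_⟩
    · exact fun h => p.disjoint hc (mem_ySet.1 (Finset.mem_sdiff.1 h).1).1
    · exact fun c hc => List.mem_toFinset.2 (mem_ySet.1 (Finset.mem_sdiff.1 hc).1).1
  · intro s hs
    obtain ⟨hs, hsw⟩ := Finset.mem_filter.1 hs
    obtain ⟨-, h2, h3⟩ := le_iff.1 hsw
    symm
    refine eq_deleteAll h3.symm (fun c hc => ?_) fun c hc => ?_
    · exact (s.mem_or hc).elim (mem_full.1 hw c) (h2 c hc)
    · have := w.mem_or hc
      have := mem_full.1 hs c
      simp only [Finset.mem_sdiff, mem_ySet]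
      tauto

theorem eq_bot_of_sets_eq_empty {w : ShufflePoset p} (hx : w.xMissing = ∅) (hy : w.ySet = ∅) :
    w = ⊥ := by
  refine le_antisymm ?_ bot_le
  refine le_iff.2 ⟨fun c hc hx' => ?_, fun c hc hy' => ?_, ?_⟩
  · by_contra h
    exact Finset.notMem_empty c (hx ▸ mem_xMissing.2 ⟨hx', h⟩)
  · exact (Finset.notMem_empty c (hy ▸ mem_ySet.2 ⟨hy', hc⟩)).elim
  · exact (le_iff.1 (bot_le (a := w))).2.2.symm

open scoped Classical in
theorem sum_Iic_signedCount (w : ShufflePoset p) :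
    ∑ v ∈ Finset.Icc ⊥ w, signedCount v = if ⊥ = w then 1 else 0 := by
  have h0 : ∑ v ∈ Finset.Icc ⊥ w, signedCount v
      = ∑ v, signedCount v * if v ≤ w then 1 else 0 := by
    simp only [mul_ite, mul_one, mul_zero]
    rw [← Finset.sum_filter]
    exact Finset.sum_congr (by ext; simp) fun _ _ => rfl
  -- For fixed `s`, the admissible `D` are the subsets of `w.xMissing`, and their alternating sum is
  -- `0` unless that set is empty.
  have h1 : ∀ s ∈ full p, (∑ D ∈ p.x.toFinset.powerset,
      (-1 : ℤ) ^ (D.card + s.ySet.card) * if s.deleteAll D ≤ w then 1 else 0) =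
      if s ≤ w then (if w.xMissing = ∅ then 1 else 0) * (-1) ^ s.ySet.card else 0 := by
    intro s hs
    have h2 : ∀ D ∈ p.x.toFinset.powerset,
        ((-1 : ℤ) ^ (D.card + s.ySet.card) * if s.deleteAll D ≤ w then 1 else 0) =
        if D ⊆ w.xMissing then (if s ≤ w then (-1) ^ D.card * (-1) ^ s.ySet.card else 0) else 0 := by
      intro D hD
      simp only [deleteAll_le_iff (mem_full.1 hs) (Finset.mem_powerset.1 hD), pow_add]
      split_ifs <;> simp_all
    rw [Finset.sum_congr rfl h2, ← Finset.sum_filter]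
    have h3 : p.x.toFinset.powerset.filter (· ⊆ w.xMissing) = w.xMissing.powerset := by
      ext D
      simp only [Finset.mem_filter, Finset.mem_powerset, and_iff_right_iff_imp]
      exact fun h => h.trans (Finset.filter_subset _ _)
    rw [h3]
    split_ifs with h4 h5
    · simp [h5]
    · rw [← Finset.sum_mul, Finset.sum_powerset_neg_one_pow_card, if_neg ‹_›]
    · simp
  have h2 := sum_signedCount_mul (R := ℤ) fun v : ShufflePoset p => if v ≤ w then 1 else 0
  simp only [Int.cast_id] at h2
  rw [h0, h2, Finset.sum_congr rfl h1, ← Finset.sum_filter, ← Finset.mul_sum]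
  by_cases hx : w.xMissing = ∅
  · have hw : w ∈ full p := mem_full.2 fun c hc => by
      by_contra h
      exact Finset.notMem_empty c (hx ▸ mem_xMissing.2 ⟨hc, h⟩)
    rw [sum_full_le hw, if_pos hx, one_mul]
    refine if_congr ⟨fun hy => (eq_bot_of_sets_eq_empty hx hy).symm, ?_⟩ rfl rfl
    rintro rfl
    ext c
    simpa [mem_ySet] using fun hy (hx' : c ∈ (⊥ : ShufflePoset p).word) => p.disjoint hx' hy
  · rw [if_neg hx, zero_mul, if_neg]
    rintro rfl
    refine hx ?_
    ext c
    simpa [mem_xMissing] using fun h : c ∈ p.x => show c ∈ (⊥ : ShufflePoset p).word from h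

/-- Both sides satisfy the same recursion over `[⊥, w]`, which determines the value at `w` from
those strictly below. -/
theorem mu_bot (w : ShufflePoset p) :
    IncidenceAlgebra.mu ℤ (⊥ : ShufflePoset p) w = signedCount w := by
  induction w using WellFoundedLT.induction with
  | ind w ih =>
    have h1 := IncidenceAlgebra.sum_Icc_mu_right (𝕜 := ℤ) (⊥ : ShufflePoset p) w
    have h2 := sum_Iic_signedCount w
    rw [← Finset.sum_Ico_add_eq_sum_Icc bot_le] at h1 h2
    rw [Finset.sum_congr rfl fun v hv => ih v (Finset.mem_Ico.1 hv).2] at h1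
    split_ifs at h1 h2 <;> linarith

/-! ### Counting full elements -/

/-- These elements are exactly the shuffles of `x` with the subword of `y` on the letters `E`. -/
theorem card_full_ySet_eq {E : Finset A} (hE : E ⊆ p.y.toFinset) :
    ((full p).filter fun s => s.ySet = E).card = (m + E.card).choose E.card := by
  have hEy : ∀ c ∈ E, c ∈ p.y := fun c hc => List.mem_toFinset.1 (hE hc)
  have hlen : (p.y.filter (fun c => decide (c ∈ E))).length = E.card := by
    rw [← List.toFinset_card_of_nodup (p.nodup_y.filter _)]
    congr 1
    ext c
    simpa using hEy c
  obtain ⟨S, hS, hS'⟩ := exists_finset_filter_eq (fun c => decide (c ∈ p.x)) p.x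
    (p.y.filter (fun c => decide (c ∈ E))) (by simp)
    (fun c hc => by simpa using fun hx => p.disjoint hx (List.mem_filter.1 hc).1)
  rw [hlen, p.length_x] at hS
  rw [← hS]
  refine Finset.card_bij (fun s _ => s.word) ?_ (fun _ _ _ _ h => word_injective h) ?_
  · intro s hs
    obtain ⟨hf, rfl⟩ := Finset.mem_filter.1 hs
    rw [hS']
    constructor
    · exact s.restrict_x_comm.symm.trans
        (List.filter_eq_self.2 fun c hc => by simpa using mem_full.1 hf c hc)
    · have h : s.word.filter (fun c => !decide (c ∈ p.x)) = restrict s.word p.y :=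
        List.filter_congr fun c hc => by
          have := s.mem_or hc
          have := @p.disjoint c
          grind
      rw [h, ← s.restrict_y_comm]
      exact List.filter_congr fun c hc => by simp [mem_ySet, hc]
  · intro l hl
    obtain ⟨h1, h2⟩ := (hS' l).1 hl
    -- The two filtered parts of `l` together permute `l`, so its letters and their distinctness can
    -- be read off from them.
    have hperm := List.filter_append_perm (fun c => decide (c ∈ p.x)) l
    rw [h1, h2] at hperm
    have hmem : ∀ c, c ∈ l ↔ c ∈ p.x ∨ c ∈ p.y.filter (fun c => decide (c ∈ E)) := fun c => by
      rw [← hperm.mem_iff, List.mem_append]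
    have hsh : IsShuffle p.x (p.y.filter (fun c => decide (c ∈ E))) l := by
      refine ⟨hperm.nodup_iff.1 (p.nodup_x.append (p.nodup_y.filter _) fun c hx hy =>
        p.disjoint hx (List.mem_filter.1 hy).1), hmem, h1, ?_⟩
      refine Eq.trans (List.filter_congr fun c hc => ?_) h2
      have := (hmem c).1 hc
      have := @p.disjoint c
      simp only [List.mem_filter, decide_eq_true_eq] at *
      grind
    refine ⟨⟨l, p.x, _, List.Sublist.refl _, List.filter_sublist, hsh⟩,
      Finset.mem_filter.2 ⟨mem_full.2 fun c hc => (hmem c).2 (Or.inl hc), ?_⟩, rfl⟩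
    ext c
    have h3 : c ∈ p.y ∧ c ∈ l ↔ c ∈ E := by
      rw [hmem]
      have := @p.disjoint c
      have := hEy c
      simp only [List.mem_filter, decide_eq_true_eq]
      tauto
    exact mem_ySet.trans h3

theorem sum_full {R : Type*} [CommRing R] (f : ℕ → R) :
    ∑ s ∈ full p, f s.ySet.card =
      ∑ i ∈ Finset.range (n + 1), (n.choose i : R) * ((m + i).choose i : R) * f i := by
  have h : ∀ s ∈ full p, s.ySet ∈ p.y.toFinset.powerset := fun s _ =>
    Finset.mem_powerset.2 (Finset.filter_subset _ _)
  rw [← Finset.sum_fiberwise_of_maps_to h]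
  have h2 : ∀ E ∈ p.y.toFinset.powerset,
      ∑ s ∈ (full p).filter (fun s => s.ySet = E), f s.ySet.card =
        ((m + E.card).choose E.card : R) * f E.card := by
    intro E hE
    rw [Finset.sum_congr rfl (g := fun _ => f E.card)
      fun s hs => by rw [(Finset.mem_filter.1 hs).2], Finset.sum_const,
      card_full_ySet_eq (Finset.mem_powerset.1 hE), nsmul_eq_mul]
  rw [Finset.sum_congr rfl h2,
    Finset.sum_powerset_apply_card fun i => ((m + i).choose i : R) * f i, card_y]
  simp only [nsmul_eq_mul, mul_assoc]

/-! ### The top element and the characteristic polynomial -/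

theorem ySet_top : (⊤ : ShufflePoset p).ySet = p.y.toFinset := by
  ext c
  simpa [mem_ySet] using fun h : c ∈ p.y => show c ∈ (⊤ : ShufflePoset p).word from h

theorem rank_top : (⊤ : ShufflePoset p).rank = m + n := by
  have h1 : (⊤ : ShufflePoset p).xMissing = p.x.toFinset := by
    ext c
    simpa [mem_xMissing] using fun h (h' : c ∈ (⊤ : ShufflePoset p).word) => p.disjoint h h'
  rw [rank_eq, h1, ySet_top, card_x, card_y]

/-- Deleting letters of `x` from a full `s` can produce `⊤` exactly when `s` contains all of `y`. -/
theorem signedCount_top :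
    signedCount (⊤ : ShufflePoset p) = (-1) ^ (m + n) * ((m + n).choose n : ℤ) := by
  classical
  have h := card_full_ySet_eq (p := p) (Finset.Subset.refl p.y.toFinset)
  rw [card_y] at h
  rw [signedCount, ← Finset.sum_filter, Finset.sum_const, rank_top, nsmul_eq_mul, mul_comm, ← h]
  congr 3
  ext s
  simp only [Finset.mem_filter]
  exact and_congr_right fun _ =>
    ⟨fun hs => (ySet_eq_of_mem_xDeletions hs).trans ySet_top, mem_xDeletions_top⟩

theorem sum_powerset_x (p : DisjointWords A m n) :
    ∑ D ∈ p.x.toFinset.powerset, (-1 : ℤ[X]) ^ D.card * X ^ (m - D.card) = (X - 1) ^ m := by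
  have := Finset.sum_pow_mul_eq_add_pow (-1 : ℤ[X]) X p.x.toFinset
  rwa [card_x, neg_add_eq_sub] at this

theorem charPoly_eq (p : DisjointWords A m n) :
    charPoly (ShufflePoset p) = (X - 1) ^ m * ∑ i ∈ Finset.range (n + 1),
      (-1) ^ i * (n.choose i : ℤ[X]) * ((m + i).choose i : ℤ[X]) * X ^ (n - i) := by
  have hg : ∀ w : ShufflePoset p, grade ℕ w = w.rank := fun _ => rfl
  simp only [charPoly, mu_bot, hg, rank_top, eq_intCast]
  rw [sum_signedCount_mul, Finset.sum_congr rfl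
    (g := fun s => (X - 1 : ℤ[X]) ^ m * ((-1) ^ s.ySet.card * X ^ (n - s.ySet.card)))]
  · rw [← Finset.mul_sum, sum_full fun i => (-1 : ℤ[X]) ^ i * X ^ (n - i)]
    exact congrArg (fun q => (X - 1 : ℤ[X]) ^ m * q) (Finset.sum_congr rfl fun i _ => by ring)
  · intro s hs
    rw [← sum_powerset_x p, Finset.sum_mul]
    refine Finset.sum_congr rfl fun D hD => ?_
    have hD := Finset.mem_powerset.1 hD
    have h1 := Finset.card_le_card hD
    have h2 : s.ySet.card ≤ _ := Finset.card_le_card (Finset.filter_subset _ _)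
    rw [card_x] at h1
    rw [card_y] at h2
    -- The truncated exponent splits because `D.card ≤ m` and `s.ySet.card ≤ n`.
    rw [rank_deleteAll (mem_full.1 hs) hD,
      show m + n - (D.card + s.ySet.card) = (m - D.card) + (n - s.ySet.card) by omega]
    ring

end ShufflePoset
end Shuffle

theorem proposition14 {A : Type*} [DecidableEq A] (m n : ℕ) (p : Shuffle.DisjointWords A m n) :
    Shuffle.charPoly (Shuffle.ShufflePoset p) =
        (X - 1) ^ m * ∑ i ∈ Finset.range (n + 1),
          (-1) ^ i * (n.choose i : ℤ[X]) * ((m + i).choose i : ℤ[X]) * X ^ (n - i) ∧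
      IncidenceAlgebra.mu ℤ (⊥ : Shuffle.ShufflePoset p) ⊤ =
        (-1) ^ (m + n) * ((m + n).choose n : ℤ) := by
  exact ⟨Shuffle.ShufflePoset.charPoly_eq p,
    (Shuffle.ShufflePoset.mu_bot _).trans Shuffle.ShufflePoset.signedCount_top⟩
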